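/- Let $G$ be a finite undirected graph (loops and parallel edges allowed) with edge weights $\mathrm{wt}(e)$ in a commutative ring $R$, and with a designated set $\partial V\subseteq V(G)$ of boundary vertices. A *grove* is a spanning forest of $G$ each of whose component trees contains at least one vertex of $\partial V$; its weight is the product of the weights of its edges. Every grove partitions $\partial V$ according to which boundary vertices lie in the same tree. Let $Z_{\partial V}$ be the sum of the weights of the groves that induce the partition of $\partial V$ into singletons, and assume that $Z_{\partial V}$ is invertible in $R$. (If $R\neq 0$, this forces every connected component of $G$ to contain a boundary vertex.) For $k\ge 0$ and tuples $\mathbf a=(a_1,\dots,a_k)$ and $\mathbf b=(b_1,\dots,b_k)$ of boundary vertices with no vertex in common, let $\mathrm{Grove}_k(\mathbf a,\mathbf b)$ be the set of groves that induce the partition of $\partial V$ with parts $\{a_i,b_i\}$ for $1\le i\le k$ and singletons for all other boundary vertices; it is empty by definition if $\mathbf a$ or $\mathbf b$ has a repeated entry. Put $$G_k(\mathbf a,\mathbf b)=\frac1{Z_{\partial V}}\sum_{g\in \mathrm{Grove}_k(\mathbf a,\mathbf b)}\mathrm{wt}(g),\qquad \tilde G_k(\mathbf a,\mathbf b)=\sum_{\sigma\in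 S_k}\mathrm{sgn}(\sigma)\,G_k\bigl(\mathbf a,(b_{\sigma(1)},\dots,b_{\sigma(k)})\bigr).$$ Let $\partial V=A\sqcup B$ be a partition of the boundary into two sets, and fix a total order on $B$. (An order on $A$ may be given as well; it plays no role.) For $\mathbf a\in A^k$ put $$\tilde H_k(\mathbf a)=\sum_{\substack{\mathbf b=(b_1,\dots,b_k)\in B^k\\ b_1<\dots<b_k}}\tilde G_k(\mathbf a,\mathbf b).$$ Then for every even $k\ge 0$ and every $\mathbf a=(a_1,\dots,a_k)\in A^k$, the matrix $\bigl(\tilde H_2(a_i,a_j)\bigr)_{i,j=1}^k$ is skew-symmetric with zero diagonal, and $$\tilde H_k(\mathbf a)=\mathrm{Pf}\bigl(\tilde H_2(a_i,a_j)\bigr)_{i,j=1}^k .$$ Here the Pfaffian of a $k\times k$ skew-symmetric matrix $M$ is the sum over all perfect matchings of $\{1,\dots,k\}$ of $(-1)^{c}\prod M_{ij}$, where the product is over the matched pairs $i<j$ and $c$ is the number of crossings, i.e. of two matched pairs $i<j$ and $i'<j'$ with $i<i'<j<j'$. -/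

import Mathlib

/-- A weighted undirected graph-with-boundary, with vertices `V`, edges `E` and weights in `R`.
Each edge has an unordered pair of ends, so that parallel edges and loops are allowed.
The vertices outside `boundary` are the interior vertices. -/
structure BoundaryGraph (V E R : Type*) where
  ends : E → Sym2 V
  wt : E → R
  boundary : Finset V

namespace BoundaryGraph

variable {V E R : Type*}

/-- The simple graph on all of `V` that joins two distinct vertices when they are the ends of
an edge in `g`. Its connected components are those of the spanning subgraph with edge set `g`. -/
def spanning (G : BoundaryGraph V E R) (g : Finset E) : SimpleGraph V :=
  SimpleGraph.fromEdgeSet (G.ends '' (g : Set E))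

/-- The spanning subgraph with edge set `g` has no cycle: no loop (a cycle of length one),
no two parallel edges (a cycle of length two), and no cycle of length at least three. -/
structure IsForest (G : BoundaryGraph V E R) (g : Finset E) : Prop where
  no_loop : ∀ e ∈ g, ¬ (G.ends e).IsDiag
  no_parallel : Set.InjOn G.ends (g : Set E)
  acyclic : (G.spanning g).IsAcyclic

/-- A grove, given by its set of edges: a spanning forest each of whose component trees contains
at least one boundary vertex. -/
structure IsGrove (G : BoundaryGraph V E R) (g : Finset E) : Prop where
  forest : G.IsForest g
  meets_boundary : ∀ v : V, ∃ u ∈ G.boundary, (G.spanning g).Reachable v u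

/-- The groves that induce the partition of the boundary into singletons. -/
def TreeGrove (G : BoundaryGraph V E R) : Set (Finset E) :=
  {g | G.IsGrove g ∧
    ∀ u ∈ G.boundary, ∀ v ∈ G.boundary, ((G.spanning g).Reachable u v ↔ u = v)}

/-- The groves that induce the partition of the boundary whose parts are the pairs `{a i, b i}`
and singletons for all other boundary vertices (two boundary vertices lie in the same tree if and
only if they are equal or form one of these pairs). There are none when `a` or `b` has a repeated
entry. It is meant for tuples `a` and `b` of boundary vertices with no vertex in common. -/
def Grove (G : BoundaryGraph V E R) {k : ℕ} (a b : Fin k → V) : Set (Finset E) :=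
  {g | Function.Injective a ∧ Function.Injective b ∧ G.IsGrove g ∧
    ∀ u ∈ G.boundary, ∀ v ∈ G.boundary, ((G.spanning g).Reachable u v ↔
      (u = v ∨ ∃ i, (u = a i ∧ v = b i) ∨ (u = b i ∧ v = a i)))}

variable [Fintype E] [CommRing R]

open Classical in
/-- The sum of the weights of the groves in `G.TreeGrove`; the weight of a grove is the product of
the weights of its edges. -/
noncomputable def Z (G : BoundaryGraph V E R) : R :=
  ∑ g : Finset E with g ∈ G.TreeGrove, ∏ e ∈ g, G.wt e

open Classical in
/-- `G_k(a, b)`. Here `Ring.inverse` is the inverse in `R` when `G.Z` is a unit. -/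
noncomputable def groveSum (G : BoundaryGraph V E R) {k : ℕ} (a b : Fin k → V) : R :=
  Ring.inverse G.Z * ∑ g : Finset E with g ∈ G.Grove a b, ∏ e ∈ g, G.wt e

/-- The signed sum `G̃_k(a, b) = ∑ σ, sgn σ * G_k(a, b_σ)`. -/
noncomputable def signedGroveSum (G : BoundaryGraph V E R) {k : ℕ} (a b : Fin k → V) : R :=
  ∑ σ : Equiv.Perm (Fin k), ((Equiv.Perm.sign σ : ℤ) : R) * G.groveSum a (fun i => b (σ i))

open Classical in
/-- `H̃_k(a)`: the sum of `G̃_k(a, b)` over the increasing `k`-tuples `b` in `B`. -/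
noncomputable def H (G : BoundaryGraph V E R) (B : Finset V) [LinearOrder B] {k : ℕ}
    (a : Fin k → V) : R :=
  ∑ b : Fin k → B with StrictMono b, G.signedGroveSum a (fun i => (b i : V))

end BoundaryGraph

/-- The Pfaffian of a `k × k` skew-symmetric matrix, as a sum over the perfect matchings of
the index set. A perfect matching is given by the map `m` that sends each index to its partner; its
term is the product of the above-diagonal entries `M i (m i)` at the matched pairs `i < m i`, with
sign given by the parity of the number of crossings `i < j < m i < m j`. -/
def pfaffian {R : Type*} [CommRing R] {k : ℕ} (M : Matrix (Fin k) (Fin k) R) : R :=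
  ∑ m : Fin k → Fin k with ∀ i, m (m i) = i ∧ m i ≠ i,
    (-1) ^ (Finset.card {p : Fin k × Fin k | p.1 < p.2 ∧ p.2 < m p.1 ∧ m p.1 < m p.2}) *
      ∏ i : Fin k with i < m i, M i (m i)

open Equiv Finset

/-! Signed grove sums are determinants. Take the minor of the weighted Laplacian whose rows are `a`
and the interior and whose columns are `b` and the interior. Cauchy–Binet expands it over edge sets,
each contributing a product of two incidence minors. That product is zero unless the edge set is a
grove pairing the `a i` with the `b j`; for such a grove it is `(-1) ^ k` times the sign of the
pairing (`sum_sign_grove_eq`, `det_laplacian_submatrix`). For `k = 0` the minor is the determinant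
of the interior Laplacian, which is therefore `Z`. Dividing by it amounts to taking a Schur
complement, so `G̃_k(a, b)` is a minor of the response matrix (`signedGroveSum_eq_det`).

Hence `H̃_k(a)` is a sum of `k × k` minors of the matrix `T` formed by the rows `a` and columns `B`
of the response matrix. For even `k` the minor summation formula (`sum_strictMono_det_eq_pfaffian`)
evaluates this sum as the Pfaffian of `T S Tᵀ`, with `S` the sign matrix of the order on `B`. The
same formula for `k = 2` identifies the entries of `T S Tᵀ` as the `H̃_2(a i, a j)`.

The minor summation formula holds because the Pfaffian of `orderSign (b i) (b j)` is the sign of the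
permutation sorting `b`, or zero if `b` has a repetition. Once it replaces that sign, the sum runs
over all tuples `b` and, for each matching, factors over the matched pairs. -/

/-! ### Crossing parity and the Pfaffian under permutations. -/

theorem Fin.swap_castSucc_succ_lt_iff {n : ℕ} (i : Fin n) {p q : Fin (n + 1)}
    (h : ¬ (p = i.castSucc ∧ q = i.succ)) (h' : ¬ (p = i.succ ∧ q = i.castSucc)) :
    swap i.castSucc i.succ p < swap i.castSucc i.succ q ↔ p < q := by
  simp only [Fin.ext_iff, Fin.val_castSucc, Fin.val_succ] at h h'
  simp only [swap_apply_def, Fin.ext_iff, Fin.val_castSucc, Fin.val_succ]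
  split_ifs <;> simp only [Fin.lt_def, Fin.val_castSucc, Fin.val_succ] <;> omega

/-- The crossings of a matching `m` of `Fin k`. -/
def crossings {k : ℕ} (m : Fin k → Fin k) : Finset (Fin k × Fin k) :=
  {p : Fin k × Fin k | p.1 < p.2 ∧ p.2 < m p.1 ∧ m p.1 < m p.2}

/-- The perfect matchings of `Fin k`. -/
def matchings (k : ℕ) : Finset (Fin k → Fin k) := {m | ∀ i, m (m i) = i ∧ m i ≠ i}

theorem neg_one_pow_card_eq_neg {α R : Type*} [Ring R] [DecidableEq α] {s t : Finset α} {a : α}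
    (ha : a ∈ s ↔ a ∉ t) (h : ∀ b, b ≠ a → (b ∈ s ↔ b ∈ t)) :
    (-1 : R) ^ #s = -(-1) ^ #t := by
  by_cases hs : a ∈ s
  · have : s = insert a t := by
      ext b; by_cases hb : b = a
      · simp [hb, hs]
      · simp [hb, h b hb]
    rw [this, card_insert_of_notMem (ha.1 hs), pow_succ]; simp
  · have : t = insert a s := by
      ext b; by_cases hb : b = a
      · subst hb; simp; tauto
      · simp [hb, h b hb]
    rw [this, card_insert_of_notMem hs, pow_succ]; simp

/-- Exchanging two adjacent points that are not matched changes the number of crossings by one. -/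
theorem neg_one_pow_card_crossings_conj {n : ℕ} {R : Type*} [Ring R] (i : Fin n)
    {m : Fin (n + 1) → Fin (n + 1)} (hm : m ∈ matchings (n + 1)) (hi : m i.castSucc ≠ i.succ) :
    (-1 : R) ^ #(crossings (swap i.castSucc i.succ ∘ m ∘ swap i.castSucc i.succ)) =
      -(-1) ^ #(crossings m) := by
  simp only [matchings, mem_filter, mem_univ, true_and] at hm
  set s := swap i.castSucc i.succ with hs
  have hcard : #(crossings (s ∘ m ∘ s)) =
      #{q : Fin (n + 1) × Fin (n + 1) | s q.1 < s q.2 ∧ s q.2 < s (m q.1) ∧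
        s (m q.1) < s (m q.2)} := by
    refine card_equiv (s.prodCongr s) fun p => ?_
    have h : ∀ x, s (s x) = x := fun x => by simp [hs]
    simp [crossings, h]
  rw [hcard]
  obtain ⟨u, hu⟩ : ∃ u, m i.castSucc = u := ⟨_, rfl⟩
  obtain ⟨v, hv⟩ : ∃ v, m i.succ = v := ⟨_, rfl⟩
  have hxy : i.castSucc < i.succ := Fin.castSucc_lt_succ
  have hsx : s i.castSucc = i.succ := by simp [hs]
  have hsy : s i.succ = i.castSucc := by simp [hs]
  have hux : m u = i.castSucc := by rw [← hu, (hm _).1]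
  have hvy : m v = i.succ := by rw [← hv, (hm _).1]
  have hux' : u ≠ i.castSucc := by rw [← hu]; exact (hm _).2
  have hvy' : v ≠ i.succ := by rw [← hv]; exact (hm _).2
  have huy : u ≠ i.succ := by rw [← hu]; exact hi
  have hvx : v ≠ i.castSucc := by rintro rfl; exact huy (hu.symm.trans hvy)
  have huv : u ≠ v := by rintro rfl; exact hxy.ne (hux.symm.trans hvy)
  have hsu : s u = u := swap_apply_of_ne_of_ne hux' huy
  have hsv : s v = v := swap_apply_of_ne_of_ne hvx hvy'
  have hmi : ∀ p q, m p = q ↔ p = m q := fun p q =>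
    ⟨fun h => by rw [← h, (hm _).1], fun h => by rw [h, (hm _).1]⟩
  have key : ∀ p q : Fin (n + 1), ¬ (p = i.castSucc ∧ q = i.succ) →
      ¬ (p = i.succ ∧ q = i.castSucc) → (s p < s q ↔ p < q) :=
    fun p q => Fin.swap_castSucc_succ_lt_iff i
  -- The exchange affects a comparison only between the two exchanged points. Each of the three
  -- comparisons defining a crossing meets them for two pairs, so six pairs are exceptional.
  have gen : ∀ p q, (p, q) ≠ (i.castSucc, i.succ) → (p, q) ≠ (i.succ, i.castSucc) →
      (p, q) ≠ (u, i.succ) → (p, q) ≠ (v, i.castSucc) → (p, q) ≠ (u, v) → (p, q) ≠ (v, u) →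
      ((s p < s q ∧ s q < s (m p) ∧ s (m p) < s (m q)) ↔ (p < q ∧ q < m p ∧ m p < m q)) := by
    intro p q h1 h2 h3 h4 h5 h6
    simp only [ne_eq, Prod.mk.injEq] at h1 h2 h3 h4 h5 h6
    rw [key p q h1 h2, key q (m p), key (m p) (m q)]
    · rw [hmi, hu, hmi, hv]; exact h5
    · rw [hmi, hv, hmi, hu]; exact h6
    · rw [hmi, hv]; tauto
    · rw [hmi, hu]; tauto
  have hlt : ∀ z, z ≠ i.castSucc → z ≠ i.succ → (i.castSucc < z ↔ i.succ < z) := by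
    intro z h1 h2
    simp only [ne_eq, Fin.ext_iff, Fin.val_castSucc, Fin.val_succ, Fin.lt_def] at *
    omega
  have hltu := hlt u hux' huy
  have hltv := hlt v hvx hvy'
  -- Exactly one pair changes status: the lower ends of the two chords through the exchanged points,
  -- in the appropriate order. The cases record where the other ends `u` and `v` lie.
  obtain ⟨p0, h1, h2⟩ : ∃ p0 : Fin (n + 1) × Fin (n + 1),
      ((s p0.1 < s p0.2 ∧ s p0.2 < s (m p0.1) ∧ s (m p0.1) < s (m p0.2)) ↔
        ¬ (p0.1 < p0.2 ∧ p0.2 < m p0.1 ∧ m p0.1 < m p0.2)) ∧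
      ∀ p, p ≠ p0 → ((s p.1 < s p.2 ∧ s p.2 < s (m p.1) ∧ s (m p.1) < s (m p.2)) ↔
        (p.1 < p.2 ∧ p.2 < m p.1 ∧ m p.1 < m p.2)) := by
    have gen' : ∀ p0 : Fin (n + 1) × Fin (n + 1),
        (∀ p ∈ [(i.castSucc, i.succ), (i.succ, i.castSucc), (u, i.succ), (v, i.castSucc), (u, v),
          (v, u)], p ≠ p0 →
          ((s p.1 < s p.2 ∧ s p.2 < s (m p.1) ∧ s (m p.1) < s (m p.2)) ↔
          (p.1 < p.2 ∧ p.2 < m p.1 ∧ m p.1 < m p.2))) →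
        ∀ p, p ≠ p0 → ((s p.1 < s p.2 ∧ s p.2 < s (m p.1) ∧ s (m p.1) < s (m p.2)) ↔
        (p.1 < p.2 ∧ p.2 < m p.1 ∧ m p.1 < m p.2)) := by
      intro p0 h p hp
      by_cases hmem : p ∈ [(i.castSucc, i.succ), (i.succ, i.castSucc), (u, i.succ),
        (v, i.castSucc), (u, v), (v, u)]
      · exact h p hmem hp
      · simp only [List.mem_cons, List.not_mem_nil, or_false, not_or] at hmem
        exact gen p.1 p.2 hmem.1 hmem.2.1 hmem.2.2.1 hmem.2.2.2.1 hmem.2.2.2.2.1 hmem.2.2.2.2.2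
    clear gen key hmi hcard hm
    rcases lt_or_gt_of_ne hux' with h1 | h1 <;> rcases lt_or_gt_of_ne hvx with h2 | h2 <;>
      rcases lt_or_gt_of_ne huv with h3 | h3
    · refine ⟨(u, v), ?_, gen' _ ?_⟩ <;> simp [*] <;> grind
    · refine ⟨(v, u), ?_, gen' _ ?_⟩ <;> simp [*] <;> grind
    · refine ⟨(u, i.succ), ?_, gen' _ ?_⟩ <;> simp [*] <;> grind
    · refine ⟨(u, i.succ), ?_, gen' _ ?_⟩ <;> simp [*] <;> grind
    · refine ⟨(v, i.castSucc), ?_, gen' _ ?_⟩ <;> simp [*] <;> grind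
    · refine ⟨(v, i.castSucc), ?_, gen' _ ?_⟩ <;> simp [*] <;> grind
    · refine ⟨(i.castSucc, i.succ), ?_, gen' _ ?_⟩ <;> simp [*] <;> grind
    · refine ⟨(i.succ, i.castSucc), ?_, gen' _ ?_⟩ <;> simp [*] <;> grind
  refine neg_one_pow_card_eq_neg (a := p0) ?_ ?_
  · simpa [crossings] using h1
  · intro p hp; simpa [crossings] using h2 p hp

theorem pfaffian_eq_sum_matchings {R : Type*} [CommRing R] {k : ℕ} (M : Matrix (Fin k) (Fin k) R) :
    pfaffian M = ∑ m ∈ matchings k, (-1) ^ #(crossings m) * ∏ i : Fin k with i < m i, M i (m i) :=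
  rfl

theorem conj_mem_matchings {k : ℕ} {m : Fin k → Fin k} (σ : Perm (Fin k)) :
    σ.symm ∘ m ∘ σ ∈ matchings k ↔ m ∈ matchings k := by
  simp only [matchings, mem_filter, mem_univ, true_and, Function.comp_apply, apply_symm_apply]
  constructor
  · intro h i
    have := h (σ.symm i)
    simp only [apply_symm_apply] at this
    exact ⟨σ.symm.injective this.1, fun h' => this.2 (by rw [h'])⟩
  · intro h i
    exact ⟨by rw [(h _).1, symm_apply_apply], fun h' => (h (σ i)).2 (by rw [symm_apply_eq] at h'; exact h')⟩

/-- Conjugating matchings by the swap matches up the terms. If the two points are matched to each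
other, the matching is unchanged and one factor is transposed; otherwise the product is only
relabelled and the crossing parity flips. -/
theorem pfaffian_submatrix_swap {R : Type*} [CommRing R] {n : ℕ}
    (M : Matrix (Fin (n + 1)) (Fin (n + 1)) R) (hM : ∀ i j, M j i = -M i j) (i : Fin n) :
    pfaffian (M.submatrix (swap i.castSucc i.succ) (swap i.castSucc i.succ)) = -pfaffian M := by
  simp only [pfaffian_eq_sum_matchings, ← sum_neg_distrib]
  have hxy : i.castSucc < i.succ := Fin.castSucc_lt_succ
  set s := swap i.castSucc i.succ with hs
  have hss : ∀ x, s (s x) = x := fun x => by simp [hs]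
  have hsymm : s.symm = s := by simp [hs]
  refine sum_bij' (fun m _ => s ∘ m ∘ s) (fun m _ => s ∘ m ∘ s) ?_ ?_ ?_ ?_ ?_
  · intro m hm; rw [← conj_mem_matchings s, hsymm] at hm; exact hm
  · intro m hm; rw [← conj_mem_matchings s, hsymm] at hm; exact hm
  · intro m _; ext x; simp [hss]
  · intro m _; ext x; simp [hss]
  · intro m hm
    have hm' := hm
    simp only [matchings, mem_filter, mem_univ, true_and] at hm'
    by_cases hi : m i.castSucc = i.succ
    · have hi' : m i.succ = i.castSucc := by rw [← hi, (hm' _).1]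
      have hfix : ∀ z, z ≠ i.castSucc → z ≠ i.succ → s z = z ∧ s (m z) = m z := fun z h1 h2 =>
        ⟨swap_apply_of_ne_of_ne h1 h2, swap_apply_of_ne_of_ne
          (fun h => h2 (by rw [← (hm' z).1, h, hi])) (fun h => h1 (by rw [← (hm' z).1, h, hi']))⟩
      have hconj : s ∘ m ∘ s = m := by
        funext z
        by_cases h1 : z = i.castSucc
        · subst h1; simp [hs, hi', hi]
        by_cases h2 : z = i.succ
        · subst h2; simp [hs, hi', hi]
        simp [hfix z h1 h2]
      rw [hconj, ← mul_neg]
      congr 1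
      have hmem : i.castSucc ∈ ({j | j < m j} : Finset (Fin (n + 1))) := by simp [hi, hxy]
      rw [← mul_prod_erase _ _ hmem, ← mul_prod_erase _ _ hmem, ← neg_mul]
      congr 1
      · simp only [Matrix.submatrix_apply, hi]
        rw [← hM, hs, swap_apply_left, swap_apply_right]
      · refine prod_congr rfl fun z hz => ?_
        simp only [mem_erase, mem_filter, mem_univ, true_and] at hz
        have h2 : z ≠ i.succ := by
          rintro rfl
          rw [hi'] at hz
          exact absurd hz.2 hxy.not_gt
        simp [hfix z hz.1 h2]
    · rw [neg_one_pow_card_crossings_conj i hm hi, neg_mul, neg_neg]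
      congr 1
      refine prod_bij' (fun z _ => s z) (fun z _ => s z) ?_ ?_ ?_ ?_ ?_
      · intro z hz
        simp only [mem_filter, mem_univ, true_and, Function.comp_apply, hss] at hz ⊢
        rw [hs, Fin.swap_castSucc_succ_lt_iff]
        · exact hz
        · rintro ⟨rfl, h⟩; exact hi h
        · rintro ⟨rfl, h⟩; rw [h] at hz; exact absurd hz hxy.not_gt
      · intro z hz
        simp only [mem_filter, mem_univ, true_and, Function.comp_apply] at hz ⊢
        rw [← hss z, hss (s z), hs, Fin.swap_castSucc_succ_lt_iff, ← hs] at hz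
        · exact hz
        · rintro ⟨h1, h⟩; rw [← hs] at h h1; rw [h1] at h; exact hi h
        · rintro ⟨h1, h⟩
          rw [← hs] at h h1; rw [h1] at h
          exact hi (by rw [← h, (hm' _).1])
      · intro z _; exact hss z
      · intro z _; exact hss z
      · intro z _; simp [hss]

theorem pfaffian_submatrix_perm {R : Type*} [CommRing R] {k : ℕ} (σ : Perm (Fin k)) :
    ∀ M : Matrix (Fin k) (Fin k) R, (∀ i j, M j i = -M i j) →
    pfaffian (M.submatrix σ σ) = ((Perm.sign σ : ℤ) : R) * pfaffian M := by
  cases k with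
  | zero => intro M _; rw [Subsingleton.elim σ 1]; simp
  | succ n =>
    have hσ : σ ∈ Submonoid.closure (Set.range fun i : Fin n ↦ swap i.castSucc i.succ) := by
      rw [Perm.mclosure_swap_castSucc_succ]; trivial
    induction hσ using Submonoid.closure_induction with
    | mem x hx =>
      obtain ⟨i, rfl⟩ := hx
      intro M hM
      rw [pfaffian_submatrix_swap M hM, Perm.sign_swap (Fin.castSucc_lt_succ).ne]
      simp
    | one => intro M _; simp
    | mul x y _ _ hx hy =>
      intro M hM
      have : M.submatrix (x * y) (x * y) = (M.submatrix x x).submatrix y y := rfl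
      rw [this, hy (M.submatrix x x) (fun i j => hM _ _), hx M hM]
      simp only [Perm.sign_mul, Units.val_mul, Int.cast_mul]
      ring

/-! ### The Pfaffian of an order-sign matrix. -/

/-- The sign of `y - x`. -/
def orderSign {β : Type*} [LinearOrder β] (x y : β) : ℤ :=
  if x < y then 1 else if y < x then -1 else 0

theorem orderSign_swap {β : Type*} [LinearOrder β] (x y : β) :
    orderSign y x = -orderSign x y := by
  unfold orderSign
  rcases lt_trichotomy x y with h | h | h
  · simp [h, h.not_gt]
  · simp [h]
  · simp [h, h.not_gt]

/-- Matchings that do not join two given adjacent points cancel under exchanging these points.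
Imposing the pairs `{0, 1}`, `{2, 3}`, … one at a time leaves a single matching, which has no
crossing. -/
theorem sum_matchings_eq_one {k : ℕ} (hk : Even k) :
    ∑ m ∈ matchings k, (-1 : ℤ) ^ #(crossings m) = 1 := by
  have step : ∀ t : ℕ, 2 * t ≤ k → ∑ m ∈ matchings k, (-1 : ℤ) ^ #(crossings m) =
      ∑ m ∈ matchings k with ∀ i : Fin k, (i : ℕ) % 2 = 0 → (i : ℕ) < 2 * t → (m i : ℕ) = i + 1,
        (-1 : ℤ) ^ #(crossings m) := by
    intro t
    induction t with
    | zero => intro _; simp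
    | succ t ih =>
      intro ht
      obtain ⟨n, rfl⟩ : ∃ n, k = n + 1 := ⟨k - 1, by omega⟩
      rw [ih (by omega)]
      let i : Fin n := ⟨2 * t, by omega⟩
      rw [← sum_filter_add_sum_filter_not _ (fun m => m i.castSucc = i.succ), filter_filter,
        filter_filter]
      have hzero : ∑ m ∈ matchings (n + 1) with
          (∀ i : Fin (n + 1), (i : ℕ) % 2 = 0 → (i : ℕ) < 2 * t → (m i : ℕ) = i + 1) ∧
          ¬ m i.castSucc = i.succ, (-1 : ℤ) ^ #(crossings m) = 0 := by
        -- Over `ℤ` it suffices that the sum equals its own negative.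
        rw [← self_eq_neg, ← sum_neg_distrib]
        set s := swap i.castSucc i.succ with hs
        have hss : ∀ x, s (s x) = x := fun x => by simp [hs]
        have hsymm : s.symm = s := by simp [hs]
        have hmem : ∀ m ∈ ({m ∈ matchings (n + 1) |
            (∀ i : Fin (n + 1), (i : ℕ) % 2 = 0 → (i : ℕ) < 2 * t → (m i : ℕ) = i + 1) ∧
            ¬ m i.castSucc = i.succ} : Finset _), s ∘ m ∘ s ∈ ({m ∈ matchings (n + 1) |
            (∀ i : Fin (n + 1), (i : ℕ) % 2 = 0 → (i : ℕ) < 2 * t → (m i : ℕ) = i + 1) ∧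
            ¬ m i.castSucc = i.succ} : Finset _) := by
          intro m hm
          simp only [mem_filter] at hm ⊢
          obtain ⟨hm, h1, h2⟩ := hm
          refine ⟨by rw [← conj_mem_matchings s, hsymm] at hm; exact hm, ?_, ?_⟩
          · intro j hj hjt
            have e1 : s j = j := swap_apply_of_ne_of_ne
              (by simp only [ne_eq, Fin.ext_iff, Fin.val_castSucc, i]; omega)
              (by simp only [ne_eq, Fin.ext_iff, Fin.val_succ, i]; omega)
            have hmj := h1 j hj hjt
            have e2 : s (m j) = m j := swap_apply_of_ne_of_ne
              (by simp only [ne_eq, Fin.ext_iff, Fin.val_castSucc, i]; omega)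
              (by simp only [ne_eq, Fin.ext_iff, Fin.val_succ, i]; omega)
            simp [e1, e2, hmj]
          · intro h
            simp only [matchings, mem_filter, mem_univ, true_and] at hm
            apply h2
            have h3 : m i.succ = i.castSucc := by
              simpa [hs, swap_apply_eq_iff] using h
            rw [← h3, (hm _).1]
        refine sum_bij' (fun m _ => s ∘ m ∘ s) (fun m _ => s ∘ m ∘ s) hmem hmem ?_ ?_ ?_
        · intro m _; ext x; simp [hss]
        · intro m _; ext x; simp [hss]
        · intro m hm
          simp only [mem_filter] at hm
          rw [neg_one_pow_card_crossings_conj i hm.1 hm.2.2, neg_neg]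
      rw [hzero, add_zero]
      refine sum_congr (filter_congr fun m _ => ?_) fun _ _ => rfl
      constructor
      · rintro ⟨h1, h2⟩ j hj hjt
        by_cases hjt' : (j : ℕ) < 2 * t
        · exact h1 j hj hjt'
        · have : j = i.castSucc := by
            simp only [Fin.ext_iff, Fin.val_castSucc, i]; omega
          rw [this, h2]; simp
      · intro h
        refine ⟨fun j hj hjt => h j hj (by omega), ?_⟩
        have := h i.castSucc (by simp [i]) (by simp [i])
        simpa [Fin.ext_iff] using this
  obtain ⟨t, rfl⟩ := hk
  rw [step t (by omega)]
  let m0 : Fin (t + t) → Fin (t + t) := fun i =>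
    if h : (i : ℕ) % 2 = 0 then ⟨i + 1, by omega⟩ else ⟨i - 1, by omega⟩
  have hm0 : ∀ i, (m0 i : ℕ) = if (i : ℕ) % 2 = 0 then (i : ℕ) + 1 else i - 1 := by
    intro i; simp only [m0]; split_ifs <;> rfl
  rw [sum_eq_single m0]
  · have : crossings m0 = ∅ := by
      refine eq_empty_of_forall_notMem fun p hp => ?_
      simp only [crossings, mem_filter, mem_univ, true_and, Fin.lt_def, hm0] at hp
      split_ifs at hp <;> omega
    simp [this]
  · intro m hm hne
    refine absurd ?_ hne
    simp only [mem_filter, matchings, mem_univ, true_and] at hm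
    funext i
    rw [Fin.ext_iff, hm0]
    split_ifs with hi
    · exact hm.2 i hi (by omega)
    · have h1 := hm.2 ⟨i - 1, by omega⟩ (by simp only; omega) (by simp only; omega)
      have h2 : m ⟨i - 1, by omega⟩ = i := by
        rw [Fin.ext_iff, h1]; simp only; omega
      have h3 := (hm.1 ⟨i - 1, by omega⟩).1
      rw [h2] at h3
      rw [h3]
  · intro h
    exfalso
    apply h
    simp only [mem_filter, matchings, mem_univ, true_and, Fin.ext_iff, ne_eq, hm0]
    refine ⟨fun i => ?_, fun i hi _ => by simp [hi]⟩
    constructor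
    · split_ifs <;> omega
    · split_ifs <;> omega

theorem pfaffian_orderSign_of_strictMono {β : Type*} [LinearOrder β] {k : ℕ} (hk : Even k)
    {b : Fin k → β} (hb : StrictMono b) :
    pfaffian (Matrix.of fun i j => orderSign (b i) (b j)) = 1 := by
  refine Eq.trans ?_ (sum_matchings_eq_one hk)
  rw [pfaffian_eq_sum_matchings]
  refine sum_congr rfl fun m _ => ?_
  rw [prod_eq_one, mul_one]
  intro i hi
  simp only [mem_filter, mem_univ, true_and] at hi
  simp [orderSign, hb hi]

/-- Swapping two indices with equal values fixes the matrix but negates its Pfaffian. Working over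
`ℤ` makes this force zero, which would fail in a ring with 2-torsion. -/
theorem pfaffian_orderSign_of_not_injective {β : Type*} [LinearOrder β] {k : ℕ}
    {b : Fin k → β} (hb : ¬ Function.Injective b) :
    pfaffian (Matrix.of fun i j => orderSign (b i) (b j)) = 0 := by
  rw [Function.Injective] at hb
  push Not at hb
  obtain ⟨i, j, hij, hne⟩ := hb
  have h := pfaffian_submatrix_perm (swap i j) (Matrix.of fun i j => orderSign (b i) (b j))
    (fun i j => orderSign_swap _ _)
  have h1 : (Matrix.of fun i j => orderSign (b i) (b j)).submatrix (swap i j) (swap i j) =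
      Matrix.of fun i j => orderSign (b i) (b j) := by
    ext x y
    simp [apply_swap_eq_self hij]
  rw [h1, Perm.sign_swap hne] at h
  simp only [Units.val_neg, Units.val_one, Int.cast_neg, Int.cast_one, neg_mul, one_mul] at h
  omega

/-! ### The minor summation formula. -/

/-- An injective tuple is uniquely an increasing tuple composed with a permutation `σ`, and the
Pfaffian of its order signs is the sign of `σ`. The other tuples have coefficient zero. -/
theorem sum_strictMono_det_eq {β R : Type*} [LinearOrder β] [Fintype β] [CommRing R] {k : ℕ}
    [DecidablePred fun b : Fin k → β => StrictMono b]
    (hk : Even k) (T : Matrix (Fin k) β R) :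
    ∑ b : Fin k → β with StrictMono b, (T.submatrix id b).det =
      ∑ b : Fin k → β, ((pfaffian (Matrix.of fun i j => orderSign (b i) (b j)) : ℤ) : R) *
        ∏ i, T i (b i) := by
  classical
  rw [← sum_subset (filter_subset (fun b : Fin k → β => Function.Injective b) univ)]
  · simp only [← Matrix.det_transpose (T.submatrix id _), Matrix.det_apply']
    rw [← sum_product']
    refine sum_bij (fun p _ => p.1 ∘ p.2) ?_ ?_ ?_ ?_
    · intro p hp
      simp only [mem_product, mem_filter, mem_univ, true_and, and_true] at hp ⊢
      exact hp.injective.comp p.2.injective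
    · rintro ⟨b, σ⟩ hp ⟨b', σ'⟩ hp' h
      simp only [mem_product, mem_filter, mem_univ, true_and, and_true] at hp hp' h
      have hr : Set.range b = Set.range b' := by
        rw [← σ.surjective.range_comp b, h, σ'.surjective.range_comp]
      obtain rfl := (StrictMono.range_inj hp hp').1 hr
      congr 1
      ext i
      exact congrArg _ (hp.injective (congrFun h i))
    · intro b hb
      simp only [mem_filter, mem_univ, true_and] at hb
      refine ⟨(b ∘ Tuple.sort b, (Tuple.sort b).symm), ?_, ?_⟩
      · simp only [mem_product, mem_filter, mem_univ, true_and, and_true]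
        exact (Tuple.monotone_sort b).strictMono_of_injective (hb.comp (Tuple.sort b).injective)
      · ext i; simp
    · rintro ⟨b, σ⟩ hp
      simp only [mem_product, mem_filter, mem_univ, true_and, and_true] at hp
      have h := pfaffian_submatrix_perm σ (Matrix.of fun i j => orderSign (b i) (b j))
        (fun i j => orderSign_swap _ _)
      rw [pfaffian_orderSign_of_strictMono hk hp, mul_one] at h
      have h1 : (Matrix.of fun i j => orderSign ((b ∘ σ) i) ((b ∘ σ) j)) =
        (Matrix.of fun i j => orderSign (b i) (b j)).submatrix σ σ := rfl
      simp only [h1, h]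
      simp
  · intro b _ hb
    simp only [mem_filter, mem_univ, true_and] at hb
    rw [pfaffian_orderSign_of_not_injective hb]
    simp

/-- A fixed-point-free involution splits its domain into lower and upper ends of its pairs. -/
def involutionEquiv {α : Type*} [LinearOrder α] {m : α → α} (hm : ∀ i, m (m i) = i)
    (hne : ∀ i, m i ≠ i) : {i // i < m i} ⊕ {i // i < m i} ≃ α where
  toFun := Sum.elim (fun i => i) (fun i => m i)
  invFun i := if h : i < m i then Sum.inl ⟨i, h⟩ else
    Sum.inr ⟨m i, by rw [hm]; exact lt_of_le_of_ne (not_lt.1 h) (hne i)⟩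
  left_inv := by
    rintro (⟨i, hi⟩ | ⟨i, hi⟩)
    · simp [hi]
    · simp [hm, hi.not_gt]
  right_inv i := by
    by_cases h : i < m i <;> simp [h, hm]

theorem prod_eq_prod_pairs {α R : Type*} [LinearOrder α] [Fintype α] [CommRing R] {m : α → α}
    (hm : ∀ i, m (m i) = i) (hne : ∀ i, m i ≠ i) (f : α → R) :
    ∏ i, f i = ∏ i with i < m i, f i * f (m i) := by
  rw [← Equiv.prod_comp (involutionEquiv hm hne), Fintype.prod_sum_type, prod_mul_distrib,
    ← prod_subtype_eq_prod_filter, ← prod_subtype_eq_prod_filter]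
  simp [involutionEquiv, Finset.subtype_univ]

theorem sum_prod_eq_prod_sum_pairs {α β R : Type*} [LinearOrder α] [Fintype α] [Fintype β]
    [CommRing R] {m : α → α} (hm : ∀ i, m (m i) = i) (hne : ∀ i, m i ≠ i) (F : α → β → β → R) :
    ∑ b : α → β, ∏ i with i < m i, F i (b i) (b (m i)) =
      ∏ i with i < m i, ∑ x, ∑ y, F i x y := by
  rw [← prod_subtype_eq_prod_filter, Finset.subtype_univ]
  simp only [← Fintype.sum_prod_type', prod_univ_sum, Fintype.piFinset_univ]
  refine Fintype.sum_equiv (((involutionEquiv hm hne).symm.arrowCongr (Equiv.refl β)).trans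
    ((Equiv.sumArrowEquivProdArrow _ _ _).trans (Equiv.arrowProdEquivProdArrow _ _ _).symm))
    _ _ fun b => ?_
  rw [← prod_subtype_eq_prod_filter, Finset.subtype_univ]
  rfl

/-- The minor summation formula. -/
theorem sum_strictMono_det_eq_pfaffian {β R : Type*} [LinearOrder β] [Fintype β] [CommRing R]
    {k : ℕ} [DecidablePred fun b : Fin k → β => StrictMono b] (hk : Even k)
    (T : Matrix (Fin k) β R) :
    ∑ b : Fin k → β with StrictMono b, (T.submatrix id b).det =
      pfaffian (Matrix.of fun i j => ∑ x, ∑ y, ((orderSign x y : ℤ) : R) * (T i x * T j y)) := by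
  rw [sum_strictMono_det_eq hk]
  simp only [pfaffian_eq_sum_matchings, Int.cast_sum, sum_mul]
  rw [sum_comm]
  refine sum_congr rfl fun m hm => ?_
  simp only [matchings, mem_filter, mem_univ, true_and] at hm
  simp only [Int.cast_mul, Int.cast_pow, Int.cast_neg, Int.cast_one, mul_assoc, ← mul_sum,
    Int.cast_prod, Matrix.of_apply]
  congr 1
  -- For a fixed matching, the values of `b` at distinct matched pairs are chosen independently.
  refine Eq.trans ?_ (sum_prod_eq_prod_sum_pairs (fun i => (hm i).1) (fun i => (hm i).2)
    (fun i x y => ((orderSign x y : ℤ) : R) * (T i x * T (m i) y)))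
  refine sum_congr rfl fun b _ => ?_
  rw [prod_eq_prod_pairs (fun i => (hm i).1) (fun i => (hm i).2), ← prod_mul_distrib]

/-! ### Cauchy–Binet with a diagonal weight. -/

/-- The Cauchy–Binet formula for `A W Bᵀ` with `W` diagonal, where `c g` is the product of the two
minors with columns in `g`. -/
theorem Matrix.det_mul_diagonal_mul_transpose {n E R : Type*} [Fintype n] [DecidableEq n]
    [Fintype E] [DecidableEq E] [CommRing R] (A B : Matrix n E R) (w : E → R)
    (c : Finset E → R) (hc : ∀ g : Finset E, #g = Fintype.card n → ∃ f : n → E,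
      Function.Injective f ∧ univ.image f = g ∧
        c g = (A.submatrix id f).det * (B.submatrix id f).det) :
    (A * Matrix.diagonal w * B.transpose).det =
      ∑ g : Finset E with #g = Fintype.card n, (∏ e ∈ g, w e) * c g := by
  classical
  have h1 : (A * Matrix.diagonal w * B.transpose).det =
      ∑ p : n → E, (∏ i, w (p i) * B i (p i)) * (A.submatrix id p).det := by
    simp only [Matrix.det_apply', Matrix.mul_apply (N := B.transpose), Matrix.mul_diagonal,
      Matrix.transpose_apply, prod_univ_sum, mul_sum, Fintype.piFinset_univ, Matrix.submatrix_apply,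
      id]
    rw [sum_comm]
    refine sum_congr rfl fun p _ => sum_congr rfl fun σ _ => ?_
    simp only [mul_assoc, prod_mul_distrib]
    ring
  have h2 : ∑ p : n → E, (∏ i, w (p i) * B i (p i)) * (A.submatrix id p).det =
      ∑ p : n → E with Function.Injective p, (∏ i, w (p i) * B i (p i)) * (A.submatrix id p).det := by
    refine (sum_subset (filter_subset _ _) fun p _ hp => ?_).symm
    simp only [mem_filter, mem_univ, true_and] at hp
    rw [Function.Injective] at hp
    push Not at hp
    obtain ⟨i, j, hij, hne⟩ := hp
    rw [Matrix.det_zero_of_column_eq hne (fun k => by simp [hij]), mul_zero]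
  rw [h1, h2, ← sum_fiberwise_of_maps_to (s := ({p : n → E | Function.Injective p} : Finset (n → E)))
    (t := ({g : Finset E | #g = Fintype.card n} : Finset (Finset E)))
    (g := fun p : n → E => univ.image p)]
  · refine sum_congr rfl fun g hg => ?_
    simp only [mem_filter, mem_univ, true_and] at hg
    obtain ⟨f, hinj, himg, hcg⟩ := hc g hg
    have h3 : ∑ p : n → E with (Function.Injective p ∧ univ.image p = g),
        (∏ i, w (p i) * B i (p i)) * (A.submatrix id p).det =
        ∑ τ : Perm n, (∏ i, w (f (τ i)) * B i (f (τ i))) *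
          (A.submatrix id (f ∘ τ)).det := by
      symm
      refine sum_bij (fun τ _ => f ∘ τ) ?_ ?_ ?_ ?_
      · intro τ _
        simp only [mem_filter, mem_univ, true_and]
        refine ⟨hinj.comp τ.injective, ?_⟩
        rw [← image_image, image_univ_equiv, himg]
      · intro τ _ τ' _ h
        ext i
        exact hinj (congrFun h i)
      · intro p hp
        simp only [mem_filter, mem_univ, true_and] at hp
        have : ∀ i, ∃ j, f j = p i := by
          intro i
          have : p i ∈ univ.image f := by rw [himg, ← hp.2]; simp
          simpa using this
        choose t ht using this
        have ht' : Function.Injective t := fun i j h => hp.1 (by rw [← ht, ← ht, h])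
        exact ⟨Equiv.ofBijective t (Finite.injective_iff_bijective.1 ht'), mem_univ _,
          funext fun i => ht i⟩
      · intro τ _; rfl
    rw [filter_filter, h3, hcg, mul_left_comm, ← Matrix.det_transpose (B.submatrix id f),
      Matrix.det_apply' (B.submatrix id f).transpose, mul_sum, mul_sum]
    refine sum_congr rfl fun τ _ => ?_
    have h4 : (A.submatrix id (f ∘ τ)) = (A.submatrix id f).submatrix id τ := rfl
    have h5 : ∏ e ∈ g, w e = ∏ i, w (f (τ i)) := by
      rw [Equiv.prod_comp τ (fun i => w (f i))]
      conv_lhs => rw [← himg]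
      exact prod_image fun i _ j _ h => hinj h
    rw [h4, Matrix.det_permute', h5, prod_mul_distrib]
    simp only [Matrix.transpose_apply, Matrix.submatrix_apply, id]
    ring
  · intro p hp
    simp only [mem_filter, mem_univ, true_and] at hp ⊢
    rw [card_image_of_injective _ hp, card_univ]

/-! ### Minors of the incidence matrix: vertices outside the range of `ρ` act as roots. -/

namespace BoundaryGraph

variable {V E R : Type*}

/-- The signed incidence matrix for an arbitrary orientation of the edges. -/
noncomputable def inc [DecidableEq V] (G : BoundaryGraph V E R) : Matrix V E ℤ := fun v e =>
  (if v = (Quot.out (G.ends e)).1 then 1 else 0) - (if v = (Quot.out (G.ends e)).2 then 1 else 0)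

theorem mk_out_ends (G : BoundaryGraph V E R) (e : E) :
    s((Quot.out (G.ends e)).1, (Quot.out (G.ends e)).2) = G.ends e :=
  Quot.out_eq (G.ends e)

/-- The sign `c` absorbs the arbitrary orientation. -/
theorem exists_inc_eq [DecidableEq V] (G : BoundaryGraph V E R) {e : E} {x y : V}
    (he : G.ends e = s(x, y)) : ∃ c : ℤ, c * c = 1 ∧
      ∀ v, G.inc v e = c * ((if v = x then 1 else 0) - (if v = y then 1 else 0)) := by
  have h := (G.mk_out_ends e).trans he
  rw [Sym2.eq_iff] at h
  rcases h with ⟨h1, h2⟩ | ⟨h1, h2⟩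
  · exact ⟨1, by ring, fun v => by simp [inc, h1, h2]⟩
  · exact ⟨-1, by ring, fun v => by simp [inc, h1, h2]⟩

theorem spanning_adj (G : BoundaryGraph V E R) {g : Finset E} {x y : V} :
    (G.spanning g).Adj x y ↔ (∃ e ∈ g, G.ends e = s(x, y)) ∧ x ≠ y := by
  simp [spanning]

theorem reachable_of_ends (G : BoundaryGraph V E R) {g : Finset E} {e : E} (he : e ∈ g) {x y : V}
    (h : G.ends e = s(x, y)) : (G.spanning g).Reachable x y := by
  by_cases hxy : x = y
  · rw [hxy]
  · exact SimpleGraph.Adj.reachable (G.spanning_adj.2 ⟨⟨e, he, h⟩, hxy⟩)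

theorem spanning_mono (G : BoundaryGraph V E R) {g g' : Finset E} (h : g ⊆ g') :
    G.spanning g ≤ G.spanning g' := by
  intro x y hxy
  rw [spanning_adj] at hxy ⊢
  obtain ⟨⟨e, he, h1⟩, h2⟩ := hxy
  exact ⟨⟨e, h he, h1⟩, h2⟩

/-- Each vertex is joined by `g` to a vertex outside the range of `ρ`. -/
def Reaches (G : BoundaryGraph V E R) {n : Type*} (g : Finset E) (ρ : n → V) : Prop :=
  ∀ v, ∃ s, s ∉ Set.range ρ ∧ (G.spanning g).Reachable v s

theorem sum_comp_eq_of_injective {n : Type*} [Fintype n] [Fintype V] {ρ : n → V} (hρ : Function.Injective ρ) {f : V → ℤ}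
    (hf : ∀ v, v ∉ Set.range ρ → f v = 0) : ∑ i, f (ρ i) = ∑ v, f v :=
  Fintype.sum_of_injective ρ hρ _ _ hf fun _ => rfl

section Minors

variable [DecidableEq V] (G : BoundaryGraph V E R) {g : Finset E}
  {n m : Type*} [Fintype m]

theorem sum_mul_inc_eq [Fintype V] {e : E} {x y : V} (he : G.ends e = s(x, y)) {χ : V → ℤ} :
    ∃ c : ℤ, c * c = 1 ∧ ∑ v, χ v * G.inc v e = c * (χ x - χ y) := by
  obtain ⟨c, hc, h⟩ := G.exists_inc_eq he
  refine ⟨c, hc, ?_⟩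
  simp [h, mul_sub, sum_sub_distrib]
  ring

theorem sum_mul_inc_eq_zero [Fintype V] {e : E} {χ : V → ℤ}
    (h : ∀ x y, G.ends e = s(x, y) → χ x = χ y) : ∑ v, χ v * G.inc v e = 0 := by
  obtain ⟨c, -, hc⟩ := G.sum_mul_inc_eq (χ := χ) (G.mk_out_ends e).symm
  rw [hc, h _ _ (G.mk_out_ends e).symm, sub_self, mul_zero]

/-- Along a walk from `v` to `s` the edge columns telescope, with signs, to the difference of the
unit vectors at `v` and `s`. If `s` is a root, its unit vector has no coordinate among the chosen
rows, so every unit vector is an integral combination of columns. -/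
theorem exists_right_inverse [DecidableEq n] {ρ : n → V} (h : G.Reaches g ρ) (hρ : Function.Injective ρ)
    {p : m → E} (hp : ∀ e ∈ g, ∃ j, p j = e) :
    ∃ P : Matrix m n ℤ, G.inc.submatrix ρ p * P = 1 := by
  classical
  have key : ∀ v s, (G.spanning g).Reachable v s →
      (fun i => (if ρ i = v then 1 else 0) - (if ρ i = s then 1 else 0) : n → ℤ) ∈
        LinearMap.range (G.inc.submatrix ρ p).mulVecLin := by
    intro v s hvs
    obtain ⟨w⟩ := hvs
    induction w with
    | nil =>
      simp only [sub_self]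
      exact Submodule.zero_mem (LinearMap.range (G.inc.submatrix ρ p).mulVecLin)
    | @cons x y z hxy _ ih =>
      obtain ⟨⟨e, he, hends⟩, -⟩ := G.spanning_adj.1 hxy
      obtain ⟨c, hc, hinc⟩ := G.exists_inc_eq hends
      obtain ⟨j, rfl⟩ := hp e he
      have h1 : (G.inc.submatrix ρ p).mulVecLin (Pi.single j c) ∈
        LinearMap.range (G.inc.submatrix ρ p).mulVecLin := LinearMap.mem_range_self _ _
      convert Submodule.add_mem _ h1 ih using 1
      funext i
      simp only [Matrix.mulVecLin_apply, Matrix.mulVec_single, Pi.add_apply, Pi.smul_apply,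
        Matrix.col_apply, Matrix.submatrix_apply, hinc, MulOpposite.smul_eq_mul_unop,
        MulOpposite.unop_op]
      linear_combination (-((if ρ i = x then 1 else 0) - (if ρ i = y then 1 else 0))) * hc
  have key2 : ∀ k : n, ∃ c : m → ℤ, (G.inc.submatrix ρ p).mulVecLin c = Pi.single k 1 := by
    intro k
    obtain ⟨s, hs, hr⟩ := h (ρ k)
    obtain ⟨c, hc⟩ := key _ _ hr
    refine ⟨c, hc.trans ?_⟩
    funext i
    have : ρ i ≠ s := fun h => hs ⟨i, h⟩
    simp [this, hρ.eq_iff, Pi.single_apply]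
  choose c hc using key2
  refine ⟨Matrix.of fun j k => c k j, ?_⟩
  ext i k
  have := congrFun (hc k) i
  rw [Matrix.mulVecLin_apply] at this
  simpa [Matrix.mul_apply, Matrix.one_apply, Pi.single_apply, Matrix.mulVec, dotProduct] using this

variable [Fintype n]

theorem card_le_of_reaches {ρ : n → V} (h : G.Reaches g ρ) (hρ : Function.Injective ρ) :
    Fintype.card n ≤ #g := by
  classical
  obtain ⟨P, hP⟩ := G.exists_right_inverse h hρ (p := fun e : g => (e : E))
    (fun e he => ⟨⟨e, he⟩, rfl⟩)
  have h1 := Matrix.rank_mul_le_left (G.inc.submatrix ρ fun e : g => (e : E)) P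
  rw [hP, Matrix.rank_one] at h1
  simpa using h1.trans (Matrix.rank_le_card_width _)

theorem det_mul_self_of_reaches [DecidableEq n] {ρ : n → V} (h : G.Reaches g ρ) (hρ : Function.Injective ρ)
    {p : n → E} (hp : ∀ e ∈ g, ∃ j, p j = e) :
    (G.inc.submatrix ρ p).det * (G.inc.submatrix ρ p).det = 1 := by
  obtain ⟨P, hP⟩ := G.exists_right_inverse h hρ hp
  have h1 := congrArg Matrix.det hP
  rw [Matrix.det_mul, Matrix.det_one] at h1
  exact Int.isUnit_mul_self (IsUnit.of_mul_eq_one _ h1)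

/-- The indicator of a component without a root is supported on the chosen rows and annihilates
every edge column. -/
theorem det_eq_zero_of_not_reaches [DecidableEq n] [Fintype V] {ρ : n → V} (h : ¬ G.Reaches g ρ)
    (hρ : Function.Injective ρ) {p : n → E} (hp : ∀ j, p j ∈ g) :
    (G.inc.submatrix ρ p).det = 0 := by
  classical
  simp only [Reaches, not_forall, not_exists, not_and] at h
  obtain ⟨v, hv⟩ := h
  let χ : V → ℤ := fun u => if (G.spanning g).Reachable v u then 1 else 0
  obtain ⟨k, hk⟩ : v ∈ Set.range ρ := by
    by_contra h; exact hv v h (SimpleGraph.Reachable.refl v)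
  rw [← Matrix.exists_vecMul_eq_zero_iff]
  refine ⟨χ ∘ ρ, fun h0 => ?_, ?_⟩
  · have := congrFun h0 k
    simp [χ, hk] at this
  · funext j
    simp only [Matrix.vecMul, dotProduct, Matrix.submatrix_apply, Function.comp_apply,
      Pi.zero_apply]
    rw [sum_comp_eq_of_injective hρ (f := fun u => χ u * G.inc u (p j))]
    · refine G.sum_mul_inc_eq_zero fun x y hxy => ?_
      have hr := G.reachable_of_ends (hp j) hxy
      have : (G.spanning g).Reachable v x ↔ (G.spanning g).Reachable v y :=
        ⟨fun h => h.trans hr, fun h => h.trans hr.symm⟩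
      simp [χ, this]
    · intro u hu
      have : ¬ (G.spanning g).Reachable v u := hv u hu
      simp [χ, this]

/-- Deleting an edge of a forest splits its tree, and one side has no root because a tree has at
most one. The signed indicator of that side pairs to one with this edge and to zero with the others.
These vectors form a left inverse of the incidence matrix, which bounds the number of columns. -/
theorem card_le_of_isForest [Fintype V] {ρ : n → V} (hρ : Function.Injective ρ)
    (hg : G.IsForest g) (hs : ∀ s ∉ Set.range ρ, ∀ t ∉ Set.range ρ,
      (G.spanning g).Reachable s t → s = t) : #g ≤ Fintype.card n := by
  classical
  have key : ∀ e : g, ∃ χ : V → ℤ, (∀ v ∉ Set.range ρ, χ v = 0) ∧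
      (∀ e' : g, e' ≠ e → ∑ v, χ v * G.inc v e' = 0) ∧ ∑ v, χ v * G.inc v e = 1 := by
    rintro ⟨e, he⟩
    obtain ⟨x, y, hxy⟩ : ∃ x y, G.ends e = s(x, y) := ⟨_, _, (G.mk_out_ends e).symm⟩
    have hne : x ≠ y := fun h => hg.no_loop e he (by rw [hxy, h]; simp)
    have hbr : ¬ (G.spanning (g.erase e)).Reachable x y := by
      intro hr
      have := SimpleGraph.isAcyclic_iff_forall_adj_isBridge.1 hg.acyclic
        (G.spanning_adj.2 ⟨⟨e, he, hxy⟩, hne⟩)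
      rw [SimpleGraph.isBridge_iff] at this
      refine this (hr.mono fun u v huv => ?_)
      obtain ⟨⟨e', he', h1⟩, h2⟩ := G.spanning_adj.1 huv
      rw [mem_erase] at he'
      rw [SimpleGraph.deleteEdges_adj]
      refine ⟨G.spanning_adj.2 ⟨⟨e', he'.2, h1⟩, h2⟩, fun h => ?_⟩
      rw [Set.mem_singleton_iff] at h
      exact he'.1 (hg.no_parallel (by simpa using he'.2) (by simpa using he)
        (by rw [h1, h, hxy]))
    have hsub := G.spanning_mono (g.erase_subset e)
    -- Stated for either end of `e`, since the rootless side may be that of `x` or of `y`.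
    have step : ∀ x y, G.ends e = s(x, y) → ¬ (G.spanning (g.erase e)).Reachable x y →
        (∀ v ∉ Set.range ρ, ¬ (G.spanning (g.erase e)).Reachable x v) →
        ∃ χ : V → ℤ, (∀ v ∉ Set.range ρ, χ v = 0) ∧
        (∀ e' : g, e' ≠ ⟨e, he⟩ → ∑ v, χ v * G.inc v e' = 0) ∧ ∑ v, χ v * G.inc v e = 1 := by
      intro x y hxy hbr hx
      let χ : V → ℤ := fun v => if (G.spanning (g.erase e)).Reachable x v then 1 else 0
      obtain ⟨c, hc, hsum⟩ := G.sum_mul_inc_eq (χ := χ) hxy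
      refine ⟨fun v => c * χ v, fun v hv => by simp [χ, hx v hv], fun e' he' => ?_, ?_⟩
      · refine G.sum_mul_inc_eq_zero fun u w huw => ?_
        have hr := G.reachable_of_ends (g := g.erase e)
          (mem_erase.2 ⟨fun h => he' (Subtype.ext h), e'.2⟩) huw
        have : (G.spanning (g.erase e)).Reachable x u ↔ (G.spanning (g.erase e)).Reachable x w :=
          ⟨fun h => h.trans hr, fun h => h.trans hr.symm⟩
        simp [χ, this]
      · simp only [mul_assoc, ← mul_sum, hsum]
        simp [χ, hbr, hc]
    by_cases hx : ∀ v ∉ Set.range ρ, ¬ (G.spanning (g.erase e)).Reachable x v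
    · exact step x y hxy hbr hx
    · refine step y x (by rw [hxy, Sym2.eq_swap]) (fun h => hbr h.symm) fun t ht hyt => hx ?_
      intro s hs' hxs
      have hst : s = t := hs s hs' t ht (((hxs.mono hsub).symm.trans
        (G.reachable_of_ends he hxy)).trans (hyt.mono hsub))
      subst hst
      exact hbr (hxs.trans hyt.symm)
  choose χ hχ1 hχ2 hχ3 using key
  have hP : (Matrix.of fun (e : g) (i : n) => χ e (ρ i)) *
      G.inc.submatrix ρ (fun e : g => (e : E)) = 1 := by
    ext e e'
    simp only [Matrix.mul_apply, Matrix.of_apply, Matrix.submatrix_apply, Matrix.one_apply]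
    rw [sum_comp_eq_of_injective hρ (f := fun u => χ e u * G.inc u e')
      (fun v hv => by simp [hχ1 e v hv])]
    split_ifs with h
    · rw [← h, hχ3]
    · exact hχ2 e e' (Ne.symm h)
  have h1 := Matrix.rank_mul_le_left (Matrix.of fun (e : g) (i : n) => χ e (ρ i))
    (G.inc.submatrix ρ (fun e : g => (e : E)))
  rw [hP, Matrix.rank_one] at h1
  simpa using h1.trans (Matrix.rank_le_card_width _)

/-- If the ends stayed joined, deleting the edge would preserve all connections to the roots while
leaving fewer edges than `card_le_of_reaches` requires. -/
theorem not_reachable_erase {ρ : n → V} (h : G.Reaches g ρ) (hρ : Function.Injective ρ)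
    (hcard : #g ≤ Fintype.card n) [DecidableEq E] {e : E} (he : e ∈ g) {x y : V}
    (hxy : G.ends e = s(x, y)) : ¬ (G.spanning (g.erase e)).Reachable x y := by
  intro hr
  have key : ∀ u v, (G.spanning g).Reachable u v → (G.spanning (g.erase e)).Reachable u v := by
    intro u v huv
    obtain ⟨w⟩ := huv
    induction w with
    | nil => exact SimpleGraph.Reachable.refl _
    | @cons a b c hab _ ih =>
      refine SimpleGraph.Reachable.trans ?_ ih
      obtain ⟨⟨e', he', h1⟩, -⟩ := G.spanning_adj.1 hab
      by_cases hee : e' = e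
      · subst hee
        rw [hxy, Sym2.eq_iff] at h1
        rcases h1 with ⟨rfl, rfl⟩ | ⟨rfl, rfl⟩
        · exact hr
        · exact hr.symm
      · exact G.reachable_of_ends (mem_erase.2 ⟨hee, he'⟩) h1
  have h2 : G.Reaches (g.erase e) ρ := fun v => by
    obtain ⟨s, hs, hvs⟩ := h v
    exact ⟨s, hs, key _ _ hvs⟩
  have h3 := G.card_le_of_reaches h2 hρ
  have h4 := card_erase_lt_of_mem he
  omega

theorem isForest_of_reaches {ρ : n → V} (h : G.Reaches g ρ) (hρ : Function.Injective ρ)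
    (hcard : #g ≤ Fintype.card n) : G.IsForest g := by
  classical
  have hno_loop : ∀ e ∈ g, ¬ (G.ends e).IsDiag := by
    intro e he hd
    obtain ⟨x, y, hxy⟩ : ∃ x y, G.ends e = s(x, y) := ⟨_, _, (G.mk_out_ends e).symm⟩
    rw [hxy, Sym2.mk_isDiag_iff] at hd
    subst hd
    exact G.not_reachable_erase h hρ hcard he hxy (SimpleGraph.Reachable.refl _)
  refine ⟨hno_loop, ?_, ?_⟩
  · intro e he e' he' hee
    by_contra hne
    obtain ⟨x, y, hxy⟩ : ∃ x y, G.ends e = s(x, y) := ⟨_, _, (G.mk_out_ends e).symm⟩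
    exact G.not_reachable_erase h hρ hcard he hxy (G.reachable_of_ends
      (mem_erase.2 ⟨Ne.symm hne, by simpa using he'⟩) (by rw [← hee, hxy]))
  · rw [SimpleGraph.isAcyclic_iff_forall_adj_isBridge]
    intro x y hadj
    obtain ⟨⟨e, he, hxy⟩, hne⟩ := G.spanning_adj.1 hadj
    rw [SimpleGraph.isBridge_iff]
    intro hr
    refine G.not_reachable_erase h hρ hcard he hxy (hr.mono fun u v huv => ?_)
    rw [SimpleGraph.deleteEdges_adj] at huv
    obtain ⟨⟨e', he', h1⟩, h2⟩ := G.spanning_adj.1 huv.1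
    refine G.spanning_adj.2 ⟨⟨e', mem_erase.2 ⟨?_, he'⟩, h1⟩, h2⟩
    rintro rfl
    exact huv.2 (by simp [← h1, hxy])

/-- If two distinct roots were joined, one could be demoted to a chosen row; every vertex would
still reach a root, but now more edges would be needed. -/
theorem eq_of_reachable_of_reaches {ρ : n → V} (h : G.Reaches g ρ) (hρ : Function.Injective ρ)
    (hcard : #g ≤ Fintype.card n) {s t : V} (hs : s ∉ Set.range ρ) (ht : t ∉ Set.range ρ)
    (hst : (G.spanning g).Reachable s t) : s = t := by
  by_contra hne
  let ρ' : Option n → V := fun o => o.elim t ρ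
  have hρ' : Function.Injective ρ' := by
    rintro (_ | i) (_ | j) hij
    · rfl
    · exact absurd ⟨j, hij.symm⟩ ht
    · exact absurd ⟨i, hij⟩ ht
    · exact congrArg some (hρ hij)
  have hmem : ∀ u, u ∉ Set.range ρ → u ≠ t → u ∉ Set.range ρ' := by
    rintro u hu hut ⟨_ | i, hi⟩
    · exact hut hi.symm
    · exact hu ⟨i, hi⟩
  have h' : G.Reaches g ρ' := by
    intro v
    obtain ⟨u, hu, hvu⟩ := h v
    by_cases hut : u = t
    · subst hut
      exact ⟨s, hmem s hs hne, hvu.trans hst.symm⟩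
    · exact ⟨u, hmem u hu hut, hvu⟩
  have h3 := G.card_le_of_reaches h' hρ'
  rw [Fintype.card_option] at h3
  omega

end Minors

end BoundaryGraph

/-! ### Groves and products of two incidence minors. -/

namespace BoundaryGraph

variable {V E R : Type*}

/-- The vertices listed by `a`, followed by the interior vertices. -/
def withInterior (G : BoundaryGraph V E R) {k : ℕ} (a : Fin k → V) :
    Fin k ⊕ {v // v ∉ G.boundary} → V := Sum.elim a Subtype.val

section Groves

variable (G : BoundaryGraph V E R) {g : Finset E} {k : ℕ} {a b : Fin k → V}

theorem notMem_range_withInterior {v : V} :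
    v ∉ Set.range (G.withInterior a) ↔ v ∈ G.boundary ∧ ∀ i, a i ≠ v := by
  simp only [withInterior, Set.mem_range, Sum.exists, Sum.elim_inl, Sum.elim_inr, Subtype.exists,
    not_or, not_exists]
  constructor
  · rintro ⟨h1, h2⟩
    exact ⟨by by_contra h; exact h2 v h rfl, h1⟩
  · rintro ⟨h1, h2⟩
    exact ⟨h2, fun w hw h => hw (h ▸ h1)⟩

theorem withInterior_injective (ha : Function.Injective a) (hab : ∀ i, a i ∈ G.boundary) :
    Function.Injective (G.withInterior a) := by
  rintro (i | ⟨v, hv⟩) (j | ⟨w, hw⟩) h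
  · exact congrArg _ (ha h)
  · exact absurd ((show a i = w from h) ▸ hab i) hw
  · exact absurd ((show v = a j from h) ▸ hab j) hv
  · exact congrArg _ (Subtype.ext h)

theorem grove_of_fin_zero (a b : Fin 0 → V) : G.Grove a b = G.TreeGrove := by
  ext g
  exact ⟨fun h => ⟨h.2.2.1, fun u hu v hv => (h.2.2.2 u hu v hv).trans (by simp)⟩,
    fun h => ⟨Function.injective_of_subsingleton _, Function.injective_of_subsingleton _, h.1,
      fun u hu v hv => (h.2 u hu v hv).trans (by simp)⟩⟩

theorem reachable_of_mem_grove (ha : ∀ i, a i ∈ G.boundary) (hb : ∀ i, b i ∈ G.boundary)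
    (hg : g ∈ G.Grove a b) (i : Fin k) : (G.spanning g).Reachable (a i) (b i) :=
  (hg.2.2.2 _ (ha i) _ (hb i)).2 (Or.inr ⟨i, Or.inl ⟨rfl, rfl⟩⟩)

theorem reaches_of_mem_grove (ha : ∀ i, a i ∈ G.boundary) (hb : ∀ i, b i ∈ G.boundary)
    (hab : ∀ i j, a i ≠ b j) (hg : g ∈ G.Grove a b) : G.Reaches g (G.withInterior a) := by
  intro v
  obtain ⟨u, hu, hvu⟩ := hg.2.2.1.meets_boundary v
  by_cases h : ∃ i, a i = u
  · obtain ⟨i, rfl⟩ := h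
    exact ⟨b i, G.notMem_range_withInterior.2 ⟨hb i, fun j => hab j i⟩,
      hvu.trans (G.reachable_of_mem_grove ha hb hg i)⟩
  · exact ⟨u, G.notMem_range_withInterior.2 ⟨hu, not_exists.1 h⟩, hvu⟩

theorem perm_eq_of_mem_grove (hbi : Function.Injective b) (ha : ∀ i, a i ∈ G.boundary)
    (hb : ∀ i, b i ∈ G.boundary) (hab : ∀ i j, a i ≠ b j) {σ τ : Perm (Fin k)}
    (hσ : g ∈ G.Grove a (fun i => b (σ i))) (hτ : g ∈ G.Grove a (fun i => b (τ i))) : σ = τ := by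
  ext i
  have h := G.reachable_of_mem_grove ha (fun i => hb (σ i)) hσ i
  rcases (hτ.2.2.2 _ (ha i) _ (hb (σ i))).1 h with h | ⟨j, ⟨h1, h2⟩ | ⟨h1, h2⟩⟩
  · exact absurd h (hab _ _)
  · rw [hbi h2, hτ.1 h1]
  · exact absurd h1 (hab _ _)

variable [Fintype V] [DecidableEq V]

theorem card_of_mem_grove (ha : ∀ i, a i ∈ G.boundary) (hb : ∀ i, b i ∈ G.boundary)
    (hab : ∀ i j, a i ≠ b j) (hg : g ∈ G.Grove a b) :
    #g = Fintype.card (Fin k ⊕ {v // v ∉ G.boundary}) := by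
  have hinj := G.withInterior_injective hg.1 ha
  refine le_antisymm (G.card_le_of_isForest hinj hg.2.2.1.forest fun s hs t ht hst => ?_)
    (G.card_le_of_reaches (G.reaches_of_mem_grove ha hb hab hg) hinj)
  rw [notMem_range_withInterior] at hs ht
  rcases (hg.2.2.2 s hs.1 t ht.1).1 hst with h | ⟨i, h | h⟩
  · exact h
  · exact absurd h.1.symm (hs.2 i)
  · exact absurd h.2.symm (ht.2 i)

/-- By minimality each tree contains exactly one boundary vertex outside `a` and exactly one outside
`b`. In the tree of `a i` the latter is `a i` itself, so the former must belong to `b`; this defines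
the pairing. -/
theorem exists_perm_mem_grove (hai : Function.Injective a) (hbi : Function.Injective b)
    (ha : ∀ i, a i ∈ G.boundary) (hb : ∀ i, b i ∈ G.boundary) (hab : ∀ i j, a i ≠ b j)
    (hcard : #g = Fintype.card (Fin k ⊕ {v // v ∉ G.boundary}))
    (hga : G.Reaches g (G.withInterior a)) (hgb : G.Reaches g (G.withInterior b)) :
    ∃ σ : Perm (Fin k), g ∈ G.Grove a (fun i => b (σ i)) := by
  have hia := G.withInterior_injective hai ha
  have hib := G.withInterior_injective hbi hb
  have eqa : ∀ s ∈ G.boundary, ∀ t ∈ G.boundary, (∀ i, a i ≠ s) → (∀ i, a i ≠ t) →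
      (G.spanning g).Reachable s t → s = t := fun s hs t ht hs' ht' =>
    G.eq_of_reachable_of_reaches hga hia hcard.le (G.notMem_range_withInterior.2 ⟨hs, hs'⟩)
      (G.notMem_range_withInterior.2 ⟨ht, ht'⟩)
  have eqb : ∀ s ∈ G.boundary, ∀ t ∈ G.boundary, (∀ i, b i ≠ s) → (∀ i, b i ≠ t) →
      (G.spanning g).Reachable s t → s = t := fun s hs t ht hs' ht' =>
    G.eq_of_reachable_of_reaches hgb hib hcard.le (G.notMem_range_withInterior.2 ⟨hs, hs'⟩)
      (G.notMem_range_withInterior.2 ⟨ht, ht'⟩)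
  have hpartner : ∀ i, ∃ j, (G.spanning g).Reachable (a i) (b j) := by
    intro i
    obtain ⟨s, hs, his⟩ := hga (a i)
    rw [notMem_range_withInterior] at hs
    by_contra hcon
    have h : ∀ j, b j ≠ s := fun j hj => hcon ⟨j, hj ▸ his⟩
    exact hs.2 i (eqb _ (ha i) _ hs.1 (fun j => (hab i j).symm) h his)
  choose σ hσ using hpartner
  have hσi : Function.Injective σ := fun i j hij => hai
    (eqb _ (ha i) _ (ha j) (fun l => (hab i l).symm) (fun l => (hab j l).symm)
      ((hσ i).trans (hij ▸ (hσ j).symm)))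
  let τ := Equiv.ofBijective σ (Finite.injective_iff_bijective.1 hσi)
  have hab_eq : ∀ i j, (G.spanning g).Reachable (a i) (b j) → b j = b (σ i) := fun i j h =>
    eqa _ (hb j) _ (hb _) (fun l => hab l j) (fun l => hab l _) (h.symm.trans (hσ i))
  refine ⟨τ, hai, hbi.comp τ.injective, ⟨G.isForest_of_reaches hga hia hcard.le, fun v => ?_⟩,
    fun u hu v hv => ⟨fun huv => ?_, ?_⟩⟩
  · obtain ⟨s, hs, hvs⟩ := hga v
    exact ⟨s, (G.notMem_range_withInterior.1 hs).1, hvs⟩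
  · by_cases hua : ∃ i, a i = u
    · obtain ⟨i, rfl⟩ := hua
      by_cases hvb : ∃ j, b j = v
      · obtain ⟨j, rfl⟩ := hvb
        exact Or.inr ⟨i, Or.inl ⟨rfl, hab_eq i j huv⟩⟩
      · exact Or.inl (eqb _ hu _ hv (fun j => (hab i j).symm) (not_exists.1 hvb) huv)
    · by_cases hva : ∃ i, a i = v
      · obtain ⟨i, rfl⟩ := hva
        by_cases hub : ∃ j, b j = u
        · obtain ⟨j, rfl⟩ := hub
          exact Or.inr ⟨i, Or.inr ⟨hab_eq i j huv.symm, rfl⟩⟩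
        · exact Or.inl (eqb _ hu _ hv (not_exists.1 hub) (fun j => (hab i j).symm) huv)
      · exact Or.inl (eqa _ hu _ hv (not_exists.1 hua) (not_exists.1 hva) huv)
  · rintro (rfl | ⟨i, ⟨rfl, rfl⟩ | ⟨rfl, rfl⟩⟩)
    · exact SimpleGraph.Reachable.refl _
    · exact hσ i
    · exact (hσ i).symm

/-- The incidence rows of a tree sum to zero, and the boundary vertices in the tree of `a i` are
just `a i` and `b i`. So row `b i` is minus row `a i` minus the interior rows of that tree, a block
triangular change of rows with determinant `(-1) ^ k`. -/
theorem det_inc_of_mem_grove (ha : ∀ i, a i ∈ G.boundary) (hb : ∀ i, b i ∈ G.boundary)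
    (hab : ∀ i j, a i ≠ b j) (hg : g ∈ G.Grove a b)
    {p : Fin k ⊕ {v // v ∉ G.boundary} → E} (hp : ∀ j, p j ∈ g) :
    (G.inc.submatrix (G.withInterior b) p).det =
      (-1) ^ k * (G.inc.submatrix (G.withInterior a) p).det := by
  classical
  let T : Matrix (Fin k ⊕ {v // v ∉ G.boundary}) (Fin k ⊕ {v // v ∉ G.boundary}) ℤ :=
    Matrix.fromBlocks (-1)
      (Matrix.of fun i v => if (G.spanning g).Reachable (a i) v then -1 else 0) 0 1
  have hT : T.det = (-1) ^ k := by
    simp [T, Matrix.det_neg]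
  have hmul : G.inc.submatrix (G.withInterior b) p =
      T * G.inc.submatrix (G.withInterior a) p := by
    ext i j
    rcases i with i | v
    · have h0 : ∑ v, (if (G.spanning g).Reachable (a i) v then 1 else 0) * G.inc v (p j) = 0 := by
        refine G.sum_mul_inc_eq_zero fun x y hxy => ?_
        have hr := G.reachable_of_ends (hp j) hxy
        have : (G.spanning g).Reachable (a i) x ↔ (G.spanning g).Reachable (a i) y :=
          ⟨fun h => h.trans hr, fun h => h.trans hr.symm⟩
        simp [this]
      rw [← Fintype.sum_subtype_add_sum_subtype (fun v => v ∈ G.boundary)] at h0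
      have h1 : ∀ [Fintype {v // v ∈ G.boundary}], ∑ v : {v // v ∈ G.boundary}, (if (G.spanning g).Reachable (a i) v then 1 else 0) *
          G.inc v (p j) = G.inc (a i) (p j) + G.inc (b i) (p j) := by
        intro _
        rw [Fintype.sum_eq_add (⟨a i, ha i⟩ : {v // v ∈ G.boundary}) ⟨b i, hb i⟩
          (fun h => hab i i (congrArg Subtype.val h))]
        · simp [G.reachable_of_mem_grove ha hb hg i]
        · rintro ⟨v, hv⟩ ⟨h1, h2⟩
          rw [if_neg, zero_mul]
          intro h
          rcases (hg.2.2.2 _ (ha i) _ hv).1 h with h | ⟨l, ⟨h3, h4⟩ | ⟨h3, h4⟩⟩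
          · exact h1 (Subtype.ext h.symm)
          · exact h2 (Subtype.ext (h4.trans (congrArg b (hg.1 h3).symm)))
          · exact hab _ _ h3
      replace h0 : G.inc (a i) (p j) + G.inc (b i) (p j) + ∑ v : {v // v ∉ G.boundary},
          (if (G.spanning g).Reachable (a i) v then 1 else 0) * G.inc v (p j) = 0 :=
        Eq.trans (congrArg (· + _) (Eq.symm (@h1 (Subtype.fintype fun v => v ∈ G.boundary)))) h0
      simp only [T, Matrix.mul_apply, Fintype.sum_sum_type, Matrix.fromBlocks_apply₁₁,
        Matrix.fromBlocks_apply₁₂, Matrix.submatrix_apply, withInterior, Sum.elim_inl,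
        Sum.elim_inr, Matrix.of_apply, Matrix.neg_apply, Matrix.one_apply, neg_mul, ite_mul,
        one_mul, zero_mul, sum_neg_distrib, sum_ite_eq, mem_univ, if_true] at h0 ⊢
      have h2 : ∀ v : {v // v ∉ G.boundary}, (if (G.spanning g).Reachable (a i) v then
          -G.inc v (p j) else 0) = -(if (G.spanning g).Reachable (a i) v then
          G.inc v (p j) else 0) := fun v => by split_ifs <;> simp
      simp only [h2, sum_neg_distrib]
      linear_combination h0
    · simp [T, Matrix.mul_apply, Fintype.sum_sum_type, withInterior, Matrix.one_apply]
  rw [hmul, Matrix.det_mul, hT]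

-- At most one `σ` contributes. If one does, the two minors agree up to `(-1) ^ k` and the sign of
-- `σ`, and the square of either is one; if none does, one of the minors vanishes.
open Classical in
theorem sum_sign_grove_eq (hai : Function.Injective a) (hbi : Function.Injective b)
    (ha : ∀ i, a i ∈ G.boundary) (hb : ∀ i, b i ∈ G.boundary) (hab : ∀ i j, a i ≠ b j)
    {p : Fin k ⊕ {v // v ∉ G.boundary} → E} (hpi : Function.Injective p)
    (hp : univ.image p = g) :
    (-1) ^ k * ∑ σ : Perm (Fin k), (Perm.sign σ : ℤ) *
      (if g ∈ G.Grove a (fun i => b (σ i)) then 1 else 0) =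
    (G.inc.submatrix (G.withInterior a) p).det * (G.inc.submatrix (G.withInterior b) p).det := by
  have hcard : #g = Fintype.card (Fin k ⊕ {v // v ∉ G.boundary}) := by
    rw [← hp, card_image_of_injective _ hpi, card_univ]
  have hmem : ∀ j, p j ∈ g := fun j => by rw [← hp]; simp
  have hsurj : ∀ e ∈ g, ∃ j, p j = e := fun e he => by rw [← hp] at he; simpa using he
  have hia := G.withInterior_injective hai ha
  have hib := G.withInterior_injective hbi hb
  by_cases hex : ∃ σ : Perm (Fin k), g ∈ G.Grove a (fun i => b (σ i))
  · obtain ⟨σ, hσ⟩ := hex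
    rw [sum_eq_single σ]
    · rw [if_pos hσ, mul_one]
      have h1 := G.det_inc_of_mem_grove ha (fun i => hb (σ i)) (fun i j => hab i (σ j)) hσ hmem
      have h2 := G.det_mul_self_of_reaches
        (G.reaches_of_mem_grove ha (fun i => hb (σ i)) (fun i j => hab i (σ j)) hσ) hia hsurj
      have h3 : G.inc.submatrix (G.withInterior fun i => b (σ i)) p =
          (G.inc.submatrix (G.withInterior b) p).submatrix (σ.sumCongr 1) id := by
        ext i j; rcases i with i | i <;> rfl
      rw [h3, Matrix.det_permute, Perm.sign_sumCongr, Perm.sign_one, mul_one] at h1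
      have h4 : ((Perm.sign σ : ℤˣ) : ℤ) * (Perm.sign σ : ℤˣ) = 1 := by
        rw [← Units.val_mul, Int.units_mul_self, Units.val_one]
      linear_combination (-((Perm.sign σ : ℤˣ) : ℤ) * (-1) ^ k) * h2 +
        (-((Perm.sign σ : ℤˣ) : ℤ) * (G.inc.submatrix (G.withInterior a) p).det) * h1 +
        (G.inc.submatrix (G.withInterior a) p).det *
          (G.inc.submatrix (G.withInterior b) p).det * h4
    · intro τ _ hτ
      rw [if_neg fun h => hτ (G.perm_eq_of_mem_grove hbi ha hb hab h hσ), mul_zero]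
    · simp
  · rw [sum_eq_zero fun σ _ => by rw [if_neg fun h => hex ⟨σ, h⟩, mul_zero], mul_zero]
    by_cases hga : G.Reaches g (G.withInterior a)
    · by_cases hgb : G.Reaches g (G.withInterior b)
      · exact absurd (G.exists_perm_mem_grove hai hbi ha hb hab hcard hga hgb) hex
      · rw [G.det_eq_zero_of_not_reaches hgb hib hmem, mul_zero]
    · rw [G.det_eq_zero_of_not_reaches hga hia hmem, zero_mul]

end Groves

/-! ### The Laplacian, its minors and the response matrix. -/

section Response

variable [DecidableEq V] [Fintype E] [CommRing R] (G : BoundaryGraph V E R)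
  {k : ℕ} {a b : Fin k → V}

open Classical in
/-- The weighted Laplacian. -/
noncomputable def laplacian : Matrix V V R :=
  G.inc.map (Int.castRingHom R) * Matrix.diagonal G.wt * (G.inc.map (Int.castRingHom R)).transpose

/-- The Laplacian on the interior. -/
noncomputable def interiorLaplacian : Matrix {v // v ∉ G.boundary} {v // v ∉ G.boundary} R :=
  G.laplacian.submatrix Subtype.val Subtype.val

theorem laplacian_submatrix_withInterior :
    G.laplacian.submatrix (G.withInterior a) (G.withInterior b) =
      Matrix.fromBlocks (G.laplacian.submatrix a b) (G.laplacian.submatrix a Subtype.val)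
        (G.laplacian.submatrix Subtype.val b) G.interiorLaplacian := by
  ext i j
  rcases i with i | i <;> rcases j with j | j <;> rfl

variable [Fintype V]

open Classical in
/-- The all-minors theorem, for minors containing the interior. -/
theorem det_laplacian_submatrix (hai : Function.Injective a) (hbi : Function.Injective b)
    (ha : ∀ i, a i ∈ G.boundary) (hb : ∀ i, b i ∈ G.boundary) (hab : ∀ i j, a i ≠ b j) :
    (G.laplacian.submatrix (G.withInterior a) (G.withInterior b)).det =
      (-1) ^ k * ∑ σ : Perm (Fin k), ((Perm.sign σ : ℤ) : R) *
        ∑ g : Finset E with g ∈ G.Grove a (fun i => b (σ i)), ∏ e ∈ g, G.wt e := by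
  let c : Finset E → ℤ := fun g => (-1) ^ k * ∑ σ : Perm (Fin k), (Perm.sign σ : ℤ) *
      (if g ∈ G.Grove a (fun i => b (σ i)) then 1 else 0)
  have h1 : G.laplacian.submatrix (G.withInterior a) (G.withInterior b) =
      (G.inc.map (Int.castRingHom R)).submatrix (G.withInterior a) id * Matrix.diagonal G.wt *
      ((G.inc.map (Int.castRingHom R)).submatrix (G.withInterior b) id).transpose := rfl
  rw [h1, Matrix.det_mul_diagonal_mul_transpose _ _ _ (fun g => (c g : R))]
  · have h2 : ∑ g : Finset E with #g = Fintype.card (Fin k ⊕ {v // v ∉ G.boundary}),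
        (∏ e ∈ g, G.wt e) * (c g : R) = ∑ g : Finset E, (∏ e ∈ g, G.wt e) * (c g : R) := by
      refine sum_subset (filter_subset _ _) fun g _ hg => ?_
      simp only [mem_filter, mem_univ, true_and] at hg
      have : c g = 0 := by
        simp only [c]
        rw [sum_eq_zero fun σ _ => ?_, mul_zero]
        rw [if_neg fun h => hg (G.card_of_mem_grove ha (fun i => hb (σ i))
          (fun i j => hab i (σ j)) h), mul_zero]
      rw [this, Int.cast_zero, mul_zero]
    rw [h2]
    simp only [c, Int.cast_mul, Int.cast_pow, Int.cast_neg, Int.cast_one, Int.cast_sum, mul_sum]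
    rw [sum_comm]
    refine sum_congr rfl fun σ _ => ?_
    rw [sum_filter]
    refine sum_congr rfl fun g _ => ?_
    split_ifs <;> simp
    ring
  · intro g hg
    have hcard : Fintype.card (Fin k ⊕ {v // v ∉ G.boundary}) = Fintype.card g := by simp [hg]
    let e := Fintype.equivOfCardEq hcard
    have hpi : Function.Injective fun i => (e i : E) :=
      Subtype.val_injective.comp e.injective
    have hp : univ.image (fun i => (e i : E)) = g := by
      ext x
      simp only [mem_image, mem_univ, true_and]
      constructor
      · rintro ⟨i, rfl⟩; exact (e i).2
      · intro hx; exact ⟨e.symm ⟨x, hx⟩, by simp⟩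
    refine ⟨fun i => (e i : E), hpi, hp, ?_⟩
    simp only [c]
    rw [G.sum_sign_grove_eq hai hbi ha hb hab hpi hp, Int.cast_mul]
    exact congrArg₂ _ (RingHom.map_det (Int.castRingHom R) _)
      (RingHom.map_det (Int.castRingHom R) _)

open Classical in
theorem det_interiorLaplacian : G.interiorLaplacian.det = G.Z := by
  -- With no boundary rows or columns, the minor is the whole interior Laplacian.
  have h := G.det_laplacian_submatrix (a := Fin.elim0) (b := Fin.elim0)
    (Function.injective_of_subsingleton _) (Function.injective_of_subsingleton _)
    (fun i => i.elim0) (fun i => i.elim0) (fun i => i.elim0)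
  rw [laplacian_submatrix_withInterior,
    Subsingleton.elim (G.laplacian.submatrix Subtype.val Fin.elim0) 0,
    Matrix.det_fromBlocks_zero₂₁, Matrix.det_isEmpty, one_mul] at h
  rw [h, Z]
  simp only [pow_zero, one_mul, univ_unique, sum_singleton, Perm.default_eq, Perm.sign_one,
    Units.val_one, Int.cast_one]
  refine sum_congr ?_ fun _ _ => rfl
  ext g
  refine mem_filter.trans (Iff.trans ?_ mem_filter.symm)
  exact and_congr_right fun _ => iff_of_eq (congrArg (g ∈ ·) (G.grove_of_fin_zero _ _))

/-- The response matrix. -/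
noncomputable def response : Matrix V V R :=
  -(G.laplacian -
    G.laplacian.submatrix id (Subtype.val : {v // v ∉ G.boundary} → V) * G.interiorLaplacian⁻¹ *
    G.laplacian.submatrix (Subtype.val : {v // v ∉ G.boundary} → V) id)

/-- The all-minors determinant is `Z` times the determinant of a Schur complement. The minus sign in
`response` cancels the factor `(-1) ^ k` of the all-minors theorem. -/
theorem signedGroveSum_eq_det (hZ : IsUnit G.Z) (hbi : Function.Injective b)
    (ha : ∀ i, a i ∈ G.boundary) (hb : ∀ i, b i ∈ G.boundary) (hab : ∀ i j, a i ≠ b j) :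
    G.signedGroveSum a b = (G.response.submatrix a b).det := by
  by_cases hai : Function.Injective a
  · have h := G.det_laplacian_submatrix hai hbi ha hb hab
    have hD : IsUnit G.interiorLaplacian.det := by rwa [det_interiorLaplacian]
    let _ := Matrix.invertibleOfIsUnitDet _ hD
    rw [laplacian_submatrix_withInterior, Matrix.det_fromBlocks₂₂, det_interiorLaplacian] at h
    have h1 : G.response.submatrix a b = -(G.laplacian.submatrix a b -
        G.laplacian.submatrix a (Subtype.val : {v // v ∉ G.boundary} → V) *
        ⅟G.interiorLaplacian *
        G.laplacian.submatrix (Subtype.val : {v // v ∉ G.boundary} → V) b) := by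
      rw [Matrix.invOf_eq_nonsing_inv]; rfl
    have h3 := congrArg (Ring.inverse G.Z * ·) h
    simp only [← mul_assoc, Ring.inverse_mul_cancel _ hZ, one_mul] at h3
    rw [h1, Matrix.det_neg, Fintype.card_fin, h3]
    simp only [signedGroveSum, groveSum, mul_sum]
    refine sum_congr rfl fun σ _ => sum_congr rfl fun g _ => ?_
    have h2 : ((-1 : R) ^ k) * (-1) ^ k = 1 := by rw [← mul_pow]; simp
    linear_combination (-(((Perm.sign σ : ℤ) : R) * Ring.inverse G.Z * ∏ e ∈ g, G.wt e)) * h2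
  -- If `a` has a repetition, there are no groves and the minor has two equal rows.
  · have h : ∀ b : Fin k → V, G.Grove a b = ∅ := fun b =>
      Set.eq_empty_of_forall_notMem fun g hg => hai hg.1
    rw [Function.Injective] at hai
    push Not at hai
    obtain ⟨i, j, hij, hne⟩ := hai
    rw [Matrix.det_zero_of_row_eq hne (by ext l; simp [hij])]
    simp [signedGroveSum, groveSum, h]

theorem H_eq_sum_det (hZ : IsUnit G.Z) {A B : Finset V} [LinearOrder B] (hdisj : Disjoint A B)
    (hunion : A ∪ B = G.boundary) (ha : ∀ i, a i ∈ A)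
    [DecidablePred fun b : Fin k → B => StrictMono b] :
    G.H B a = ∑ b : Fin k → B with StrictMono b,
      ((G.response.submatrix a (Subtype.val : B → V)).submatrix id b).det := by
  unfold H
  refine sum_congr (by ext; simp) fun b hb => ?_
  simp only [mem_filter, mem_univ, true_and] at hb
  refine G.signedGroveSum_eq_det hZ (Subtype.val_injective.comp hb.injective)
    (fun i => hunion ▸ mem_union_left _ (ha i)) (fun i => hunion ▸ mem_union_right _ (b i).2)
    fun i j h => ?_
  exact disjoint_left.1 hdisj (ha i) (h ▸ (b j).2)

end Response

end BoundaryGraph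

/-! ### The Pfaffian formula for groves. -/

theorem pfaffian_fin_two {R : Type*} [CommRing R] (M : Matrix (Fin 2) (Fin 2) R) :
    pfaffian M = M 0 1 := by
  have h1 : matchings 2 = {![1, 0]} := by decide
  have h2 : crossings (k := 2) ![1, 0] = ∅ := by decide
  have h3 : ({i | i < (![1, 0] : Fin 2 → Fin 2) i} : Finset (Fin 2)) = {0} := by decide
  rw [pfaffian_eq_sum_matchings, h1, sum_singleton, h2, h3]
  simp

theorem mainTheorem4 {V E R : Type*} [Fintype V] [DecidableEq V] [Fintype E] [CommRing R]
    (G : BoundaryGraph V E R) (hZ : IsUnit G.Z)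
    (A B : Finset V) [LinearOrder B] (hdisj : Disjoint A B) (hunion : A ∪ B = G.boundary)
    (k : ℕ) (hk : Even k) (a : Fin k → V) (ha : ∀ i, a i ∈ A) :
    (∀ i j, G.H B ![a j, a i] = - G.H B ![a i, a j]) ∧ (∀ i, G.H B ![a i, a i] = 0) ∧
    G.H B a = pfaffian (Matrix.of fun i j => G.H B ![a i, a j]) := by
  classical
  have hpair : ∀ i j, ∀ l : Fin 2, ![a i, a j] l ∈ A := fun i j l => by
    fin_cases l
    · exact ha i
    · exact ha j
  refine ⟨fun i j => ?_, fun i => ?_, ?_⟩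
  · rw [G.H_eq_sum_det hZ hdisj hunion (hpair j i), G.H_eq_sum_det hZ hdisj hunion (hpair i j),
      ← sum_neg_distrib]
    refine sum_congr rfl fun b _ => ?_
    simp only [Matrix.det_fin_two, Matrix.submatrix_apply, Matrix.cons_val_zero,
      Matrix.cons_val_one, id]
    ring
  · rw [G.H_eq_sum_det hZ hdisj hunion (hpair i i)]
    refine sum_eq_zero fun b _ => ?_
    simp only [Matrix.det_fin_two, Matrix.submatrix_apply, Matrix.cons_val_zero,
      Matrix.cons_val_one, id]
    ring
  · rw [G.H_eq_sum_det hZ hdisj hunion ha, sum_strictMono_det_eq_pfaffian hk]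
    congr 1
    ext i j
    -- Applying minor summation again with `k = 2` turns `H̃_2(a i, a j)` into the single
    -- above-diagonal entry of a `2 × 2` Pfaffian.
    rw [Matrix.of_apply, Matrix.of_apply, G.H_eq_sum_det hZ hdisj hunion (hpair i j),
      sum_strictMono_det_eq_pfaffian even_two, pfaffian_fin_two]
    rfl
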